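/- Let $\mathbb{F}$ be a field of characteristic different from $2$, let $a,b\in\mathbb{F}\setminus\{0\}$, and let $\mathbb{H}=\mathbb{H}(a,b)$ be the quaternion algebra over $\mathbb{F}$ with basis $1,i,j,k$ and $i^2=a$, $j^2=b$, $ij=k=-ji$ (a division algebra or split), with its conjugation $\overline{x_0+x_1i+x_2j+x_3k}=x_0-x_1i-x_2j-x_3k$. Let $n\ge 1$. For $M=(m_{pq})\in \mathrm{M}(n,\mathbb{H})$, $\sigma\in S_n$ and an index $p$, put $c_p(\sigma)=m_{p\,\sigma(p)}\,m_{\sigma(p)\,\sigma^2(p)}\cdots m_{\sigma^{-1}(p)\,p}$, the ordered product along the cycle of $\sigma$ through $p$. For an index $i$ let $p_2<\dots<p_r$ be the smallest elements of the cycles of $\sigma$ (fixed points included) that do not contain $i$. The $i$-th row and column determinants of $M$ are $$\mathrm{rdet}_i M=\sum_{\sigma\in S_n}(-1)^{n-r}\,c_i(\sigma)\,c_{p_2}(\sigma)\cdots c_{p_r}(\sigma),\qquad \mathrm{cdet}_i M=\sum_{\sigma\in S_n}(-1)^{n-r}\,c_{p_r}(\sigma)\cdots c_{p_2}(\sigma)\,c_i(\sigma).$$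 For a Hermitian matrix all of these coincide; their common value is its determinant $\det$. Let $A^*$ denote the conjugate transpose of $A$, and let $\mathrm{ddet}\,A=\det(AA^*)$ be the double determinant of $A\in\mathrm{M}(n,\mathbb{H})$. Write $M_{.j}(f)$ (resp. $M_{i.}(z)$) for the matrix obtained from $M$ by replacing its $j$-th column by the column $f$ (resp. its $i$-th row by the row $z$). Let $A\in\mathrm{M}(n,\mathbb{H})$ with $\mathrm{ddet}\,A\neq 0$. Then $\mathrm{ddet}\,A$ is a (nonzero) element of $\mathbb{F}$, and: 1. For every column $y\in\mathbb{H}^{n\times 1}$ the right system $Ax=y$ has a unique solution $x=(x_1,\dots,x_n)^T$, and with $f=A^*y$ $$x_j=\frac{\mathrm{cdet}_j\big((A^*A)_{.j}(f)\big)}{\mathrm{ddet}\,A},\qquad j=1,\dots,n.$$ 2. For every row $y\in\mathbb{H}^{1\times n}$ the left system $xA=y$ has a unique solution $x=(x_1,\dots,x_n)$, and with $z=yA^*$ $$x_i=\frac{\mathrm{rdet}_i\big((AA^*)_{i.}(z)\big)}{\mathrm{ddet}\,A},\qquad i=1,\dots,n.$$ -/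

import Mathlib

open scoped Quaternion Matrix

noncomputable section

namespace RowColDet

/-- The ordered product `a_{m, σ m} a_{σ m, σ² m} ⋯ a_{σ⁻¹ m, m}` along the cycle of `σ`
through `m`, read from `m` on (it is `a_{m, m}` if `m` is a fixed point). -/
def cycleProd {n : ℕ} {H : Type*} [Ring H] (A : Matrix (Fin n) (Fin n) H)
    (σ : Equiv.Perm (Fin n)) (m : Fin n) : H :=
  ((List.range (Function.minimalPeriod σ m)).map
    fun t => A ((σ ^ t) m) ((σ ^ (t + 1)) m)).prod

/-- The smallest elements of those cycles of `σ` (fixed points included) that do not contain `i`,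
in increasing order. -/
def leaders {n : ℕ} (σ : Equiv.Perm (Fin n)) (i : Fin n) : List (Fin n) :=
  (List.finRange n).filter fun m => ¬ σ.SameCycle i m ∧ ∀ l, σ.SameCycle m l → m ≤ l

/-- The `i`-th row determinant: in each monomial the cycle through `i` comes first, starting at
`i`; the other cycles follow, each starting at its smallest element, with these smallest elements
increasing from left to right. The sign `(-1)^(n - r)`, where `r` is the number of cycles, is the
sign of the permutation. -/
def rdet {n : ℕ} {H : Type*} [Ring H] (i : Fin n) (A : Matrix (Fin n) (Fin n) H) : H :=
  ∑ σ : Equiv.Perm (Fin n), ((Equiv.Perm.sign σ : ℤˣ) : ℤ) •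
    (cycleProd A σ i * ((leaders σ i).map (cycleProd A σ)).prod)

/-- The `j`-th column determinant: in each monomial, written from right to left, the cycle through
`j` comes first, and its rightmost factor is the one from column `j`; the other cycles follow to
the left, the rightmost factor of each lying in the column indexed by the smallest element of the
cycle, with these smallest elements increasing from right to left:
`a_{j_{k_r} j_{k_r + l_r}} ⋯ a_{j_{k_r + 1} j_{k_r}} ⋯ a_{j j_{k_1 + l_1}} ⋯ a_{j_{k_1} j}`. -/
def cdet {n : ℕ} {H : Type*} [Ring H] (j : Fin n) (A : Matrix (Fin n) (Fin n) H) : H :=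
  ∑ τ : Equiv.Perm (Fin n), ((Equiv.Perm.sign τ : ℤˣ) : ℤ) •
    (((leaders τ j).reverse.map (cycleProd A τ)).prod * cycleProd A τ j)

/-- The determinant of a Hermitian matrix: the common value of all its row and column
determinants, given here by the first row determinant. -/
def hdet {n : ℕ} [NeZero n] {H : Type*} [Ring H] (A : Matrix (Fin n) (Fin n) H) : H :=
  rdet 0 A

/-- The double determinant: the determinant of the Hermitian matrix `A A*`. -/
def ddet {n : ℕ} [NeZero n] {H : Type*} [Ring H] [StarRing H]
    (A : Matrix (Fin n) (Fin n) H) : H :=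
  hdet (A * Aᴴ)

end RowColDet

end

/-!
Replacing a permutation by the one with its cycle through `k` reversed preserves the sign and, where
`M` is Hermitian, conjugates the product along that cycle. Averaging the two replaces the product by
its scalar part. Thus the row determinants of a Hermitian matrix all equal one scalar, and `rdet i`
remains linear in row `i` when only that row is altered. It vanishes if row `i` repeats row `k`,
since multiplying a permutation by the transposition `(i k)` merges their cycles, concatenates the
cycle products and changes the sign. This gives a cofactor identity `M * adj M = det M` for
Hermitian `M`, hence Cramer's rule for `A * Aᴴ` and `Aᴴ * A`.

These two matrices have the same determinant. The bordered matrix with blocks `0, A, Aᴴ, -1` is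
`P * diag(A * Aᴴ, -1) * Pᴴ` with `P` unipotent, so its determinant is `(-1) ^ n * det (A * Aᴴ)`. In
its Leibniz expansion the block `-1` contributes nothing: a permutation carrying the first `n`
indices to the last `n` also carries the last to the first. Without that block, exchanging the two
halves turns `A` into `Aᴴ`.
-/

namespace RowColDet

open Equiv.Perm Function

/-- An `R`-algebra with involution in which `x + star x` is always a scalar. Its half is the scalar
part of `x`; it is carried as data, so that the axioms make sense without inverting `2`. -/
class ScalarPartAlgebra (R H : Type*) [CommRing R] [Ring H] [StarRing H] [Algebra R H] where
  scalarPart : H →ₗ[R] R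
  scalarPart_one : scalarPart 1 = 1
  self_add_star (x : H) : x + star x = algebraMap R H (2 * scalarPart x)

open ScalarPartAlgebra

section ScalarPart

instance {R : Type*} [CommRing R] (a b : R) : ScalarPartAlgebra R ℍ[R,a,b] where
  scalarPart := QuaternionAlgebra.reₗ a 0 b
  scalarPart_one := rfl
  self_add_star x := by
    rw [QuaternionAlgebra.self_add_star', zero_mul, add_zero]
    rfl

theorem eq_of_add_self_eq (R : Type*) {M : Type*} [Semiring R] [Invertible (2 : R)]
    [AddCommMonoid M] [Module R M] {x y : M} (h : x + x = y + y) : x = y := by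
  rw [← two_smul R x, ← two_smul R y] at h
  exact (isUnit_of_invertible (2 : R)).smul_left_cancel.mp h

variable {R H : Type*} [CommRing R] [Ring H] [StarRing H] [Algebra R H] [ScalarPartAlgebra R H]

@[simp]
theorem scalarPart_algebraMap (r : R) : scalarPart (algebraMap R H r) = r := by
  rw [Algebra.algebraMap_eq_smul_one, map_smul, scalarPart_one, smul_eq_mul, mul_one]

variable (R H) in
theorem algebraMap_injective : Injective (algebraMap R H) :=
  LeftInverse.injective (g := scalarPart) scalarPart_algebraMap

@[simp]
theorem scalarPart_star (x : H) : (scalarPart (star x) : R) = scalarPart x := by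
  have h := congrArg (scalarPart : H →ₗ[R] R) (self_add_star (R := R) x)
  rwa [map_add, scalarPart_algebraMap, two_mul, add_right_inj] at h

variable (R) in
theorem star_eq_algebraMap_sub (x : H) :
    star x = algebraMap R H (2 * scalarPart x) - x :=
  eq_sub_of_add_eq' (self_add_star x)

@[simp]
theorem star_algebraMap (r : R) : star (algebraMap R H r) = algebraMap R H r := by
  rw [star_eq_algebraMap_sub R, scalarPart_algebraMap, two_mul, map_add, add_sub_cancel_right]

theorem star_smul_scalar (r : R) (x : H) : star (r • x) = r • star x := by
  rw [Algebra.smul_def, star_mul, star_algebraMap, ← Algebra.commutes, ← Algebra.smul_def]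

theorem conjTranspose_smul_scalar {m n : Type*} (r : R) (M : Matrix m n H) : (r • M)ᴴ = r • Mᴴ :=
  Matrix.ext fun _ _ => star_smul_scalar r _

variable (R) in
theorem scalarPart_mul_comm (x y : H) : (scalarPart (x * y) : R) = scalarPart (y * x) := by
  rw [← scalarPart_star, star_mul, star_eq_algebraMap_sub R x, star_eq_algebraMap_sub R y, mul_sub,
    sub_mul, sub_mul, ← map_mul, ← Algebra.commutes _ y, ← Algebra.smul_def, ← Algebra.smul_def,
    map_sub, map_sub, map_sub, map_smul, map_smul, scalarPart_algebraMap, smul_eq_mul, smul_eq_mul]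
  ring

theorem isUnit_algebraMap_iff {r : R} : IsUnit (algebraMap R H r) ↔ IsUnit r := by
  refine ⟨fun h => ?_, fun h => h.map _⟩
  obtain ⟨x, hx⟩ := h.exists_right_inv
  refine IsUnit.of_mul_eq_one (scalarPart x) ?_
  rw [← smul_eq_mul, ← map_smul, Algebra.smul_def, hx, scalarPart_one]

variable (R) in
theorem sum_mul_mul_eq_sum_scalarPart [Invertible (2 : R)] {α : Type*} (T : Finset α) {e : α → α}
    (he : Involutive e) (heT : ∀ s ∈ T, e s ∈ T) {L c N : α → H}
    (hL : ∀ s ∈ T, L (e s) = L s) (hN : ∀ s ∈ T, N (e s) = N s)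
    (hc : ∀ s ∈ T, c (e s) = star (c s)) :
    ∑ s ∈ T, L s * c s * N s = ∑ s ∈ T, L s * algebraMap R H (scalarPart (c s)) * N s := by
  have h : ∑ s ∈ T, L s * c s * N s = ∑ s ∈ T, L s * star (c s) * N s := by
    refine Finset.sum_nbij' e e heT heT (fun s _ => he s) (fun s _ => he s) fun s hs => ?_
    rw [hL s hs, hN s hs, hc s hs, star_star]
  apply eq_of_add_self_eq R
  nth_rewrite 2 [h]
  rw [← Finset.sum_add_distrib, ← Finset.sum_add_distrib]
  refine Finset.sum_congr rfl fun s _ => ?_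
  rw [← add_mul, ← mul_add, self_add_star (R := R), two_mul, map_add, mul_add, add_mul]

end ScalarPart

section Orbit

variable {ι : Type*}

theorem pow_minimalPeriod_apply (σ : Equiv.Perm ι) (p : ι) : (σ ^ minimalPeriod σ p) p = p := by
  rw [← iterate_eq_pow, iterate_minimalPeriod]

theorem pow_apply_ne_of_lt_minimalPeriod {σ : Equiv.Perm ι} {p : ι} {t : ℕ} (h0 : 0 < t)
    (ht : t < minimalPeriod σ p) : (σ ^ t) p ≠ p := by
  rw [← iterate_eq_pow]
  exact not_isPeriodicPt_of_pos_of_lt_minimalPeriod h0.ne' ht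

theorem minimalPeriod_perm_congr {κ : Type*} {σ : Equiv.Perm ι} {τ : Equiv.Perm κ} {p : ι} {q : κ}
    (h : ∀ t : ℕ, (σ ^ t) p = p ↔ (τ ^ t) q = q) : minimalPeriod σ p = minimalPeriod τ q := by
  rw [minimalPeriod_eq_minimalPeriod_iff]
  simpa only [IsPeriodicPt, IsFixedPt, iterate_eq_pow] using h

theorem minimalPeriod_perm_inv (σ : Equiv.Perm ι) (p : ι) :
    minimalPeriod (σ⁻¹ : Equiv.Perm ι) p = minimalPeriod σ p :=
  minimalPeriod_perm_congr fun t => by rw [inv_pow, inv_eq_iff_eq, eq_comm]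

theorem sameCycle_pow_apply (σ : Equiv.Perm ι) (p : ι) (t : ℕ) : σ.SameCycle p ((σ ^ t) p) :=
  sameCycle_pow_right.mpr (SameCycle.refl _ _)

theorem pow_apply_map {κ : Type*} {σ : Equiv.Perm ι} {τ : Equiv.Perm κ} {f : κ → ι}
    (h : ∀ q, σ (f q) = f (τ q)) (t : ℕ) (q : κ) : (σ ^ t) (f q) = f ((τ ^ t) q) := by
  rw [← iterate_eq_pow, ← iterate_eq_pow]
  exact (Semiconj.iterate_right (fun q => (h q).symm) t q).symm

variable [Finite ι]

theorem minimalPeriod_perm_pos (σ : Equiv.Perm ι) (p : ι) : 0 < minimalPeriod σ p :=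
  minimalPeriod_pos_of_mem_periodicPts (σ.injective.mem_periodicPts p)

theorem minimalPeriod_eq_of_pow {σ : Equiv.Perm ι} {p : ι} {N : ℕ} (h0 : 0 < N)
    (hN : (σ ^ N) p = p) (h : ∀ t, 0 < t → t < N → (σ ^ t) p ≠ p) : minimalPeriod σ p = N := by
  refine le_antisymm (IsPeriodicPt.minimalPeriod_le h0 ?_) ?_
  · rwa [IsPeriodicPt, IsFixedPt, iterate_eq_pow]
  · by_contra! hlt
    exact h _ (minimalPeriod_perm_pos σ p) hlt (pow_minimalPeriod_apply σ p)

theorem exists_pow_lt_minimalPeriod {σ : Equiv.Perm ι} {p q : ι} (h : σ.SameCycle p q) :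
    ∃ t < minimalPeriod σ p, (σ ^ t) p = q := by
  obtain ⟨t, rfl⟩ := h.exists_nat_pow_eq
  refine ⟨t % minimalPeriod σ p, Nat.mod_lt _ (minimalPeriod_perm_pos σ p), ?_⟩
  rw [← iterate_eq_pow, iterate_mod_minimalPeriod_eq, iterate_eq_pow]

theorem mem_of_sameCycle_of_forall_apply_mem {σ : Equiv.Perm ι} {s : Set ι} (hs : ∀ x ∈ s, σ x ∈ s)
    {x y : ι} (h : σ.SameCycle x y) (hx : x ∈ s) : y ∈ s := by
  obtain ⟨t, rfl⟩ := h.exists_nat_pow_eq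
  clear h
  induction t with
  | zero => exact hx
  | succ t ih =>
    rw [pow_succ', mul_apply]
    exact hs _ ih

theorem sameCycle_of_forall_sameCycle_apply {σ τ : Equiv.Perm ι}
    (h : ∀ x, σ.SameCycle x (τ x)) {x y : ι} (hxy : τ.SameCycle x y) : σ.SameCycle x y :=
  mem_of_sameCycle_of_forall_apply_mem (s := {z | σ.SameCycle x z}) (fun z hz => hz.trans (h z)) hxy
    (SameCycle.refl _ _)

theorem sameCycle_congr_of_pow_apply {σ τ : Equiv.Perm ι} {p : ι}
    (h : ∀ t : ℕ, (σ ^ t) p = (τ ^ t) p) (q : ι) : σ.SameCycle p q ↔ τ.SameCycle p q := by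
  constructor <;> intro hq <;> obtain ⟨t, rfl⟩ := hq.exists_nat_pow_eq
  · exact h t ▸ sameCycle_pow_apply τ p t
  · exact h t ▸ sameCycle_pow_apply σ p t

end Orbit

section PathProd

variable {ι H : Type*}

section Monoid

variable [Monoid H]

/-- The product `M p (σ p) * M (σ p) (σ² p) * ⋯` of the entries of `M` met on the first `N` steps
from `p` along its `σ`-orbit. -/
def pathProd (M : Matrix ι ι H) (σ : Equiv.Perm ι) (p : ι) (N : ℕ) : H :=
  ((List.range N).map fun t => M ((σ ^ t) p) ((σ ^ (t + 1)) p)).prod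

theorem pathProd_zero (M : Matrix ι ι H) (σ : Equiv.Perm ι) (p : ι) : pathProd M σ p 0 = 1 := rfl

theorem pathProd_one (M : Matrix ι ι H) (σ : Equiv.Perm ι) (p : ι) :
    pathProd M σ p 1 = M p (σ p) := by
  simp [pathProd]

theorem pathProd_add (M : Matrix ι ι H) (σ : Equiv.Perm ι) (p : ι) (N K : ℕ) :
    pathProd M σ p (N + K) = pathProd M σ p N * pathProd M σ ((σ ^ N) p) K := by
  rw [pathProd, List.range_add, List.map_append, List.prod_append, List.map_map]
  congr 2
  refine List.map_congr_left fun t _ => ?_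
  simp only [comp_apply, ← mul_apply, ← pow_add, add_comm N, add_right_comm]

theorem pathProd_succ (M : Matrix ι ι H) (σ : Equiv.Perm ι) (p : ι) (N : ℕ) :
    pathProd M σ p (N + 1) = pathProd M σ p N * M ((σ ^ N) p) ((σ ^ (N + 1)) p) := by
  rw [pathProd_add, pathProd_one, pow_succ', mul_apply]

theorem pathProd_succ' (M : Matrix ι ι H) (σ : Equiv.Perm ι) (p : ι) (N : ℕ) :
    pathProd M σ p (N + 1) = M p (σ p) * pathProd M σ (σ p) N := by
  rw [add_comm, pathProd_add, pathProd_one, pow_one]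

theorem pathProd_congr {κ : Type*} {M : Matrix ι ι H} {M' : Matrix κ κ H} {σ : Equiv.Perm ι}
    {τ : Equiv.Perm κ} {p : ι} {q : κ} {N : ℕ}
    (h : ∀ t < N, M ((σ ^ t) p) ((σ ^ (t + 1)) p) = M' ((τ ^ t) q) ((τ ^ (t + 1)) q)) :
    pathProd M σ p N = pathProd M' τ q N :=
  congrArg List.prod (List.map_congr_left fun t ht => h t (List.mem_range.mp ht))

theorem star_pathProd {H : Type*} [Monoid H] [StarMul H] (M : Matrix ι ι H) (σ : Equiv.Perm ι)
    (p : ι) (N : ℕ) : star (pathProd M σ p N) = pathProd Mᴴ σ⁻¹ ((σ ^ N) p) N := by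
  induction N with
  | zero => rw [pathProd_zero, pathProd_zero, star_one]
  | succ N ih =>
    have hback : σ⁻¹ ((σ ^ (N + 1)) p) = (σ ^ N) p := by
      rw [inv_eq_iff_eq, pow_succ', mul_apply]
    rw [pathProd_succ, star_mul, ih, pathProd_succ', hback, Matrix.conjTranspose_apply]

/-- The ordered product of the entries of `M` along the cycle of `σ` through `p`, read from `p` on:
`cycleProd` for an arbitrary index type. -/
noncomputable def orbitProd (M : Matrix ι ι H) (σ : Equiv.Perm ι) (p : ι) : H :=
  pathProd M σ p (minimalPeriod σ p)

/-- The product of the entries of `M` along the cycle of `σ` through `p` after the first one. -/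
noncomputable def orbitTail (M : Matrix ι ι H) (σ : Equiv.Perm ι) (p : ι) : H :=
  pathProd M σ (σ p) (minimalPeriod σ p - 1)

theorem orbitProd_of_apply_eq {M : Matrix ι ι H} {σ : Equiv.Perm ι} {p : ι} (h : σ p = p) :
    orbitProd M σ p = M p p := by
  rw [orbitProd, minimalPeriod_eq_one_iff_isFixedPt.mpr h, pathProd_one, h]

theorem orbitProd_congr {M M' : Matrix ι ι H} {σ τ : Equiv.Perm ι} {p : ι}
    (hp : ∀ t : ℕ, (σ ^ t) p = (τ ^ t) p)
    (hM : ∀ q, σ.SameCycle p q → M q (σ q) = M' q (σ q)) : orbitProd M σ p = orbitProd M' τ p := by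
  have hper : minimalPeriod σ p = minimalPeriod τ p := minimalPeriod_perm_congr fun t => by rw [hp]
  rw [orbitProd, orbitProd, hper]
  refine pathProd_congr fun t _ => ?_
  rw [← hp, ← hp, pow_succ', mul_apply]
  exact hM _ (sameCycle_pow_apply σ p t)

theorem orbitTail_congr {M M' : Matrix ι ι H} {σ : Equiv.Perm ι} {p : ι}
    (hM : ∀ q, q ≠ p → M q = M' q) : orbitTail M σ p = orbitTail M' σ p := by
  refine pathProd_congr fun t ht => ?_
  rw [hM]
  rw [← mul_apply, ← pow_succ]
  exact pow_apply_ne_of_lt_minimalPeriod t.succ_pos (by omega)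

theorem orbitProd_submatrix {κ : Type*} (M : Matrix ι ι H) {σ : Equiv.Perm ι} {τ : Equiv.Perm κ}
    {f : κ → ι} (hf : Injective f) (h : ∀ q, σ (f q) = f (τ q)) (q : κ) :
    orbitProd M σ (f q) = orbitProd (M.submatrix f f) τ q := by
  have hper : minimalPeriod σ (f q) = minimalPeriod τ q :=
    minimalPeriod_perm_congr fun t => by rw [pow_apply_map h, hf.eq_iff]
  rw [orbitProd, orbitProd, hper]
  exact pathProd_congr fun t _ => congrArg₂ M (pow_apply_map h _ q) (pow_apply_map h _ q)

theorem star_orbitProd {H : Type*} [Monoid H] [StarMul H] (M : Matrix ι ι H) (σ : Equiv.Perm ι)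
    (p : ι) : star (orbitProd M σ p) = orbitProd Mᴴ σ⁻¹ p := by
  rw [orbitProd, star_pathProd, pow_minimalPeriod_apply, orbitProd, minimalPeriod_perm_inv]

variable [Finite ι]

theorem orbitProd_eq_mul_orbitTail (M : Matrix ι ι H) (σ : Equiv.Perm ι) (p : ι) :
    orbitProd M σ p = M p (σ p) * orbitTail M σ p := by
  rw [orbitProd, orbitTail, ← pathProd_succ', Nat.sub_add_cancel (minimalPeriod_perm_pos σ p)]

theorem orbitProd_apply_eq_orbitTail_mul (M : Matrix ι ι H) (σ : Equiv.Perm ι) (p : ι) :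
    orbitProd M σ (σ p) = orbitTail M σ p * M p (σ p) := by
  have hpos := minimalPeriod_perm_pos σ p
  have hback : (σ ^ (minimalPeriod σ p - 1)) (σ p) = p := by
    rw [← mul_apply, ← pow_succ, Nat.sub_add_cancel hpos, pow_minimalPeriod_apply]
  rw [orbitProd, orbitTail, minimalPeriod_apply (σ.injective.mem_periodicPts p),
    ← Nat.sub_add_cancel hpos, pathProd_succ, Nat.add_sub_cancel, pow_succ', mul_apply, hback]

end Monoid

theorem orbitProd_eq_zero_of_entry [MonoidWithZero H] [Finite ι] {M : Matrix ι ι H}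
    {σ : Equiv.Perm ι} {p q : ι} (h : σ.SameCycle p q) (hq : M q (σ q) = 0) :
    orbitProd M σ p = 0 := by
  obtain ⟨t, ht, rfl⟩ := exists_pow_lt_minimalPeriod h
  refine List.prod_eq_zero (List.mem_map.mpr ⟨t, List.mem_range.mpr ht, ?_⟩)
  rw [pow_succ', mul_apply, hq]

theorem scalarPart_orbitProd_eq_of_sameCycle {R : Type*} [CommRing R] [Ring H] [StarRing H]
    [Algebra R H] [ScalarPartAlgebra R H] [Finite ι] (M : Matrix ι ι H) {σ : Equiv.Perm ι}
    {p q : ι} (h : σ.SameCycle p q) :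
    (scalarPart (orbitProd M σ p) : R) = scalarPart (orbitProd M σ q) := by
  refine mem_of_sameCycle_of_forall_apply_mem
    (s := {x | (scalarPart (orbitProd M σ p) : R) = scalarPart (orbitProd M σ x)})
    (fun x hx => Eq.trans hx ?_) h rfl
  rw [orbitProd_apply_eq_orbitTail_mul, orbitProd_eq_mul_orbitTail, scalarPart_mul_comm]

end PathProd

section Reverse

variable {ι : Type*}

open Classical in
/-- The permutation obtained from `σ` by reversing its cycle through `k`. -/
noncomputable def revCycle (σ : Equiv.Perm ι) (k : ι) : Equiv.Perm ι where
  toFun x := if σ.SameCycle k x then σ⁻¹ x else σ x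
  invFun x := if σ.SameCycle k x then σ x else σ⁻¹ x
  left_inv x := by by_cases h : σ.SameCycle k x <;> simp [h]
  right_inv x := by by_cases h : σ.SameCycle k x <;> simp [h]

theorem revCycle_apply_of_sameCycle {σ : Equiv.Perm ι} {k x : ι} (h : σ.SameCycle k x) :
    revCycle σ k x = σ⁻¹ x := if_pos h

theorem revCycle_apply_of_not_sameCycle {σ : Equiv.Perm ι} {k x : ι} (h : ¬ σ.SameCycle k x) :
    revCycle σ k x = σ x := if_neg h

theorem revCycle_pow_apply_of_sameCycle {σ : Equiv.Perm ι} {k x : ι} (h : σ.SameCycle k x)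
    (t : ℕ) : (revCycle σ k ^ t) x = (σ⁻¹ ^ t) x := by
  induction t with
  | zero => rfl
  | succ t ih =>
    rw [pow_succ', mul_apply, ih, pow_succ', mul_apply, revCycle_apply_of_sameCycle]
    exact h.trans (sameCycle_inv.mp (sameCycle_pow_apply σ⁻¹ x t))

theorem revCycle_pow_apply_of_not_sameCycle {σ : Equiv.Perm ι} {k x : ι}
    (h : ¬ σ.SameCycle k x) (t : ℕ) : (revCycle σ k ^ t) x = (σ ^ t) x := by
  induction t with
  | zero => rfl
  | succ t ih =>
    rw [pow_succ', mul_apply, ih, pow_succ', mul_apply, revCycle_apply_of_not_sameCycle]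
    rwa [sameCycle_pow_right]

theorem sign_revCycle [Fintype ι] [DecidableEq ι] (σ : Equiv.Perm ι) (k : ι) :
    sign (revCycle σ k) = sign σ := by
  have h : revCycle σ k = σ * (cycleOf σ⁻¹ k * cycleOf σ⁻¹ k) := by
    ext x
    by_cases h : σ⁻¹.SameCycle k x
    · rw [revCycle_apply_of_sameCycle (sameCycle_inv.mp h), mul_apply, mul_apply,
        h.cycleOf_apply, SameCycle.cycleOf_apply (sameCycle_apply_right.mpr h), ← mul_apply σ,
        mul_inv_cancel, one_apply]
    · rw [revCycle_apply_of_not_sameCycle (mt sameCycle_inv.mpr h), mul_apply, mul_apply,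
        cycleOf_apply_of_not_sameCycle h, cycleOf_apply_of_not_sameCycle h]
  rw [h, map_mul, map_mul, Int.units_mul_self, mul_one]

theorem orbitProd_revCycle_of_not_sameCycle {H : Type*} [Monoid H] (M : Matrix ι ι H)
    {σ : Equiv.Perm ι} {k p : ι} (h : ¬ σ.SameCycle k p) :
    orbitProd M (revCycle σ k) p = orbitProd M σ p :=
  orbitProd_congr (revCycle_pow_apply_of_not_sameCycle h) fun _ _ => rfl

variable [Finite ι]

theorem sameCycle_revCycle {σ : Equiv.Perm ι} {k x y : ι} :
    (revCycle σ k).SameCycle x y ↔ σ.SameCycle x y := by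
  refine ⟨sameCycle_of_forall_sameCycle_apply fun x => ?_,
    sameCycle_of_forall_sameCycle_apply fun x => ?_⟩
  · by_cases h : σ.SameCycle k x
    · rw [revCycle_apply_of_sameCycle h, inv_def, sameCycle_symm_apply_right]
    · rw [revCycle_apply_of_not_sameCycle h, sameCycle_apply_right]
  · by_cases h : σ.SameCycle k x
    · have hx : revCycle σ k (σ x) = x := by
        rw [revCycle_apply_of_sameCycle (sameCycle_apply_right.mpr h), inv_def,
          Equiv.symm_apply_apply]
      rw [← sameCycle_apply_right, hx]
    · rw [← revCycle_apply_of_not_sameCycle h, sameCycle_apply_right]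

theorem revCycle_involutive (k : ι) : Involutive (revCycle · k) := fun σ => by
  ext x
  by_cases h : σ.SameCycle k x
  · rw [revCycle_apply_of_sameCycle (sameCycle_revCycle.mpr h), inv_eq_iff_eq,
      revCycle_apply_of_sameCycle (sameCycle_apply_right.mpr h), inv_def, Equiv.symm_apply_apply]
  · rw [revCycle_apply_of_not_sameCycle (mt sameCycle_revCycle.mp h),
      revCycle_apply_of_not_sameCycle h]

/-- The principal submatrix of `M` on the index set `s` is Hermitian. -/
def IsHermitianOn {ι H : Type*} [Star H] (M : Matrix ι ι H) (s : Set ι) : Prop :=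
  ∀ p ∈ s, ∀ q ∈ s, star (M q p) = M p q

theorem IsHermitianOn.mono {ι H : Type*} [Star H] {M : Matrix ι ι H} {s t : Set ι}
    (hM : IsHermitianOn M t) (hst : s ⊆ t) : IsHermitianOn M s :=
  fun p hp q hq => hM p (hst hp) q (hst hq)

theorem isHermitianOn_of_isHermitian {ι H : Type*} [Star H] {M : Matrix ι ι H}
    (hM : M.IsHermitian) (s : Set ι) : IsHermitianOn M s :=
  fun p _ q _ => hM.apply p q

theorem isHermitianOn_compl_updateRow_iff {ι H : Type*} [DecidableEq ι] [Star H]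
    {M : Matrix ι ι H} {i : ι} {u : ι → H} :
    IsHermitianOn (M.updateRow i u) {i}ᶜ ↔ IsHermitianOn M {i}ᶜ := by
  refine forall₂_congr fun p hp => forall₂_congr fun q hq => ?_
  rw [Matrix.updateRow_ne hp, Matrix.updateRow_ne hq]

theorem orbitProd_revCycle_of_sameCycle {H : Type*} [Monoid H] [StarMul H] {M : Matrix ι ι H}
    {σ : Equiv.Perm ι} {k p : ι} (hM : IsHermitianOn M {q | σ.SameCycle k q})
    (h : σ.SameCycle k p) : orbitProd M (revCycle σ k) p = star (orbitProd M σ p) := by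
  rw [star_orbitProd]
  refine orbitProd_congr (revCycle_pow_apply_of_sameCycle h) fun q hq => ?_
  have hq : σ.SameCycle k q := h.trans (sameCycle_revCycle.mp hq)
  refine (hM _ hq _ ?_).symm
  rw [Set.mem_ofPred, ← sameCycle_revCycle (k := k), sameCycle_apply_right, sameCycle_revCycle]
  exact hq

end Reverse

section Merge

open Equiv (swap)

variable {ι : Type*} [DecidableEq ι]

theorem mul_swap_pow_apply_of_not_sameCycle {σ : Equiv.Perm ι} {i k p : ι}
    (hi : ¬ σ.SameCycle i p) (hk : ¬ σ.SameCycle k p) (t : ℕ) :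
    ((σ * swap i k) ^ t) p = (σ ^ t) p := by
  induction t with
  | zero => rfl
  | succ t ih =>
    rw [pow_succ', mul_apply, ih, pow_succ', mul_apply, mul_apply, Equiv.swap_apply_of_ne_of_ne]
    · rintro rfl
      exact hi (sameCycle_pow_apply σ p t).symm
    · rintro rfl
      exact hk (sameCycle_pow_apply σ p t).symm

theorem mul_swap_pow_apply {σ : Equiv.Perm ι} {i k : ι} (hik : ¬ σ.SameCycle i k) {t : ℕ}
    (h0 : 0 < t) (ht : t ≤ minimalPeriod σ k) : ((σ * swap i k) ^ t) i = (σ ^ t) k := by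
  induction t, h0 using Nat.le_induction with
  | base => simp
  | succ t h0 ih =>
    have hi : (σ ^ t) k ≠ i := by
      rintro rfl
      exact hik (sameCycle_pow_apply σ k t).symm
    rw [pow_succ', mul_apply, ih (by omega), mul_apply,
      Equiv.swap_apply_of_ne_of_ne hi (pow_apply_ne_of_lt_minimalPeriod h0 ht), pow_succ',
      mul_apply]

theorem pathProd_mul_swap {H : Type*} [Monoid H] {M : Matrix ι ι H} {σ : Equiv.Perm ι} {i k : ι}
    (hik : ¬ σ.SameCycle i k) (hM : M i = M k) :
    pathProd M (σ * swap i k) i (minimalPeriod σ k) = orbitProd M σ k := by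
  refine pathProd_congr fun t ht => ?_
  rw [mul_swap_pow_apply hik t.succ_pos ht]
  rcases t.eq_zero_or_pos with rfl | h0
  · rw [pow_zero, pow_zero, one_apply, one_apply, hM]
  · rw [mul_swap_pow_apply hik h0 ht.le]

variable [Finite ι]

theorem mul_swap_pow_minimalPeriod_apply {σ : Equiv.Perm ι} {i k : ι} (hik : ¬ σ.SameCycle i k) :
    ((σ * swap i k) ^ minimalPeriod σ k) i = k := by
  rw [mul_swap_pow_apply hik (minimalPeriod_perm_pos σ k) le_rfl, pow_minimalPeriod_apply]

theorem mul_swap_pow_add_apply {σ : Equiv.Perm ι} {i k : ι} (hik : ¬ σ.SameCycle i k) {t : ℕ}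
    (h0 : 0 < t) (ht : t ≤ minimalPeriod σ i) :
    ((σ * swap i k) ^ (t + minimalPeriod σ k)) i = (σ ^ t) i := by
  rw [pow_add, mul_apply, mul_swap_pow_minimalPeriod_apply hik, Equiv.swap_comm,
    mul_swap_pow_apply (mt SameCycle.symm hik) h0 ht]

theorem minimalPeriod_mul_swap {σ : Equiv.Perm ι} {i k : ι} (hik : ¬ σ.SameCycle i k) :
    minimalPeriod (σ * swap i k : Equiv.Perm ι) i = minimalPeriod σ i + minimalPeriod σ k := by
  have hk := minimalPeriod_perm_pos σ k
  refine minimalPeriod_eq_of_pow (by omega) ?_ fun t h0 ht => ?_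
  · rw [mul_swap_pow_add_apply hik (minimalPeriod_perm_pos σ i) le_rfl, pow_minimalPeriod_apply]
  rcases le_or_gt t (minimalPeriod σ k) with h | h
  · rw [mul_swap_pow_apply hik h0 h]
    rintro rfl
    exact hik (sameCycle_pow_apply σ k t).symm
  · obtain ⟨s, rfl⟩ := Nat.exists_eq_add_of_le' h.le
    rw [mul_swap_pow_add_apply hik (by omega) (by omega)]
    exact pow_apply_ne_of_lt_minimalPeriod (by omega) (by omega)

theorem sameCycle_mul_swap_of_not_sameCycle {σ : Equiv.Perm ι} {i k : ι}
    (hik : ¬ σ.SameCycle i k) : (σ * swap i k).SameCycle i k := by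
  simpa only [mul_swap_pow_minimalPeriod_apply hik] using
    sameCycle_pow_apply (σ * swap i k) i (minimalPeriod σ k)

theorem sameCycle_of_sameCycle_mul_swap {σ : Equiv.Perm ι} {i k : ι} (hik : σ.SameCycle i k)
    {x y : ι} (h : (σ * swap i k).SameCycle x y) : σ.SameCycle x y := by
  refine sameCycle_of_forall_sameCycle_apply (fun z => ?_) h
  rw [mul_apply, sameCycle_apply_right, Equiv.swap_apply_def]
  split_ifs with hi hk
  · rwa [hi]
  · rw [hk]
    exact hik.symm
  · exact SameCycle.refl σ z

theorem not_sameCycle_mul_swap_of_sameCycle {σ : Equiv.Perm ι} {i k : ι} (hne : i ≠ k)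
    (hik : σ.SameCycle i k) : ¬ (σ * swap i k).SameCycle i k := by
  obtain ⟨t, ht, rfl⟩ := exists_pow_lt_minimalPeriod hik
  have ht0 : 0 < t := Nat.pos_of_ne_zero fun h => hne (by rw [h, pow_zero, one_apply])
  let arc : Set ι := {x | ∃ s, 0 < s ∧ s ≤ t ∧ (σ ^ s) i = x}
  have harc : ∀ x ∈ arc, (σ * swap i ((σ ^ t) i)) x ∈ arc := by
    rintro _ ⟨s, hs0, hst, rfl⟩
    rw [mul_apply]
    rcases hst.eq_or_lt with rfl | hlt
    · exact ⟨1, one_pos, ht0, by rw [Equiv.swap_apply_right, pow_one]⟩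
    · have hne' : (σ ^ s) i ≠ (σ ^ t) i := fun h => by
        rw [← Nat.sub_add_cancel hst, add_comm, pow_add, mul_apply,
          EmbeddingLike.apply_eq_iff_eq] at h
        exact pow_apply_ne_of_lt_minimalPeriod (by omega) (by omega) h.symm
      rw [Equiv.swap_apply_of_ne_of_ne
        (pow_apply_ne_of_lt_minimalPeriod hs0 (hst.trans_lt ht)) hne']
      exact ⟨s + 1, s.succ_pos, hlt, by rw [pow_succ', mul_apply]⟩
  intro h
  obtain ⟨s, hs0, hst, hs⟩ :=
    mem_of_sameCycle_of_forall_apply_mem harc h.symm ⟨t, ht0, le_rfl, rfl⟩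
  exact pow_apply_ne_of_lt_minimalPeriod hs0 (hst.trans_lt ht) hs

theorem sameCycle_mul_swap_left_iff {σ : Equiv.Perm ι} {i k : ι} (hik : ¬ σ.SameCycle i k)
    (p : ι) : (σ * swap i k).SameCycle i p ↔ σ.SameCycle i p ∨ σ.SameCycle k p := by
  have hmerge := sameCycle_mul_swap_of_not_sameCycle hik
  constructor
  · intro h
    by_contra! hcon
    exact hcon.1 ((sameCycle_congr_of_pow_apply
      (mul_swap_pow_apply_of_not_sameCycle hcon.1 hcon.2) i).mp h.symm).symm
  · have coarser {x y : ι} (h : σ.SameCycle x y) : (σ * swap i k).SameCycle x y := by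
      rw [← Equiv.mul_swap_mul_self i k σ] at h
      exact sameCycle_of_sameCycle_mul_swap hmerge h
    exact fun h => h.elim coarser fun hk => hmerge.trans (coarser hk)

theorem orbitProd_mul_swap {H : Type*} [Monoid H] {M : Matrix ι ι H} {σ : Equiv.Perm ι} {i k : ι}
    (hik : ¬ σ.SameCycle i k) (hM : M i = M k) :
    orbitProd M (σ * swap i k) i = orbitProd M σ k * orbitProd M σ i := by
  rw [orbitProd, minimalPeriod_mul_swap hik, add_comm, pathProd_add, pathProd_mul_swap hik hM,
    mul_swap_pow_minimalPeriod_apply hik, Equiv.swap_comm,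
    pathProd_mul_swap (mt SameCycle.symm hik) hM.symm]

theorem sum_perm_eq_sum_not_sameCycle {M : Type*} [AddCommMonoid M] [Fintype ι] {i k : ι}
    (hne : i ≠ k) (f : Equiv.Perm ι → M) :
    ∑ σ, f σ = ∑ σ with ¬ σ.SameCycle i k, (f σ + f (σ * swap i k)) := by
  rw [Finset.sum_add_distrib, ← Finset.sum_filter_not_add_sum_filter _ (SameCycle · i k)]
  congr 1
  refine Finset.sum_nbij' (· * swap i k) (· * swap i k) ?_ ?_ ?_ ?_ ?_
  · intro σ hσ
    rw [Finset.mem_filter_univ] at hσ ⊢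
    exact not_sameCycle_mul_swap_of_sameCycle hne hσ
  · intro σ hσ
    rw [Finset.mem_filter_univ] at hσ ⊢
    exact sameCycle_mul_swap_of_not_sameCycle hσ
  · exact fun σ _ => Equiv.mul_swap_mul_self i k σ
  · exact fun σ _ => Equiv.mul_swap_mul_self i k σ
  · exact fun σ _ => by rw [Equiv.mul_swap_mul_self]

end Merge

section CyclesScalar

variable {ι : Type*}

/-- The indices whose cycle under `σ` does not meet `S`. -/
def offCycles (σ : Equiv.Perm ι) (S : Set ι) : Set ι := {p | ∀ s ∈ S, ¬ σ.SameCycle s p}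

theorem mem_offCycles_of_sameCycle {σ : Equiv.Perm ι} {S : Set ι} {p q : ι}
    (hp : p ∈ offCycles σ S) (h : σ.SameCycle p q) : q ∈ offCycles σ S :=
  fun s hs hsq => hp s hs (hsq.trans h.symm)

theorem mem_offCycles_empty (σ : Equiv.Perm ι) (p : ι) : p ∈ offCycles σ ∅ :=
  fun _ hs => hs.elim

theorem mem_offCycles_singleton {σ : Equiv.Perm ι} {i p : ι} :
    p ∈ offCycles σ {i} ↔ ¬ σ.SameCycle i p := by
  simp [offCycles]

theorem mem_offCycles_insert {σ : Equiv.Perm ι} {S : Set ι} {i p : ι} :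
    p ∈ offCycles σ (insert i S) ↔ ¬ σ.SameCycle i p ∧ p ∈ offCycles σ S := by
  simp [offCycles]

/-- `p` is the smallest element of its cycle under `σ`. -/
def IsCycleMin [LE ι] (σ : Equiv.Perm ι) (p : ι) : Prop := ∀ q, σ.SameCycle p q → p ≤ q

theorem IsCycleMin.eq_of_sameCycle [PartialOrder ι] {σ : Equiv.Perm ι} {p q : ι}
    (hp : IsCycleMin σ p) (hq : IsCycleMin σ q) (h : σ.SameCycle p q) : p = q :=
  le_antisymm (hp q h) (hq p h.symm)

theorem exists_isCycleMin_sameCycle [Finite ι] [LinearOrder ι] (σ : Equiv.Perm ι) (p : ι) :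
    ∃ q, IsCycleMin σ q ∧ σ.SameCycle p q := by
  obtain ⟨q, hq, hmin⟩ := Set.exists_min_image {q | σ.SameCycle p q} id (Set.toFinite _)
    ⟨p, SameCycle.refl σ p⟩
  exact ⟨q, fun r hr => hmin r (hq.trans hr), hq⟩

theorem isCycleMin_congr [LE ι] {σ τ : Equiv.Perm ι} {p : ι}
    (h : ∀ q, σ.SameCycle p q ↔ τ.SameCycle p q) : IsCycleMin σ p ↔ IsCycleMin τ p := by
  simp only [IsCycleMin, h]

variable [Fintype ι] [LinearOrder ι] {R H : Type*} [CommRing R] [Ring H] [StarRing H] [Algebra R H]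
  [ScalarPartAlgebra R H]

variable (R) in
open Classical in
/-- The product of the scalar parts of the cycle products over the cycles of `σ` that do not
meet `S`. Each cycle is represented by its smallest element. -/
noncomputable def cyclesScalar (M : Matrix ι ι H) (σ : Equiv.Perm ι) (S : Set ι) : R :=
  ∏ p with IsCycleMin σ p ∧ p ∈ offCycles σ S, scalarPart (orbitProd M σ p)

theorem cyclesScalar_congr {M M' : Matrix ι ι H} {σ τ : Equiv.Perm ι} {S T : Set ι}
    (hoff : offCycles σ S = offCycles τ T)
    (hcyc : ∀ p ∈ offCycles σ S, ∀ q, σ.SameCycle p q ↔ τ.SameCycle p q)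
    (hM : ∀ p ∈ offCycles σ S,
      (scalarPart (orbitProd M σ p) : R) = scalarPart (orbitProd M' τ p)) :
    cyclesScalar R M σ S = cyclesScalar R M' τ T := by
  classical
  refine Finset.prod_congr (Finset.filter_congr fun p _ => ?_) fun p hp => ?_
  · rw [← hoff]
    exact and_congr_left fun hp => isCycleMin_congr (hcyc p hp)
  · exact hM p (hoff ▸ (Finset.mem_filter_univ _ |>.mp hp).2)

theorem cyclesScalar_eq_mul_insert (M : Matrix ι ι H) {σ : Equiv.Perm ι} {S : Set ι} {k : ι}
    (hk : k ∈ offCycles σ S) :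
    cyclesScalar R M σ S = scalarPart (orbitProd M σ k) * cyclesScalar R M σ (insert k S) := by
  classical
  obtain ⟨m, hm, hkm⟩ := exists_isCycleMin_sameCycle σ k
  have hmem : m ∈ ({p | IsCycleMin σ p ∧ p ∈ offCycles σ S} : Finset ι) :=
    Finset.mem_filter_univ _ |>.mpr ⟨hm, mem_offCycles_of_sameCycle hk hkm⟩
  rw [cyclesScalar, ← Finset.mul_prod_erase _ _ hmem, scalarPart_orbitProd_eq_of_sameCycle M hkm,
    cyclesScalar]
  congr 2
  ext p
  rw [Finset.mem_erase, Finset.mem_filter_univ, Finset.mem_filter_univ, mem_offCycles_insert]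
  constructor
  · rintro ⟨hpm, hp, hoff⟩
    exact ⟨hp, fun hkp => hpm (hp.eq_of_sameCycle hm (hkp.symm.trans hkm)), hoff⟩
  · rintro ⟨hp, hkp, hoff⟩
    refine ⟨?_, hp, hoff⟩
    rintro rfl
    exact hkp hkm

theorem cyclesScalar_eq_zero_of_entry {M : Matrix ι ι H} {σ : Equiv.Perm ι} {q : ι}
    (hq : M q (σ q) = 0) : cyclesScalar R M σ ∅ = 0 := by
  rw [cyclesScalar_eq_mul_insert M (mem_offCycles_empty σ q),
    orbitProd_eq_zero_of_entry (SameCycle.refl σ q) hq, map_zero, zero_mul]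

theorem cyclesScalar_updateRow (M : Matrix ι ι H) (σ : Equiv.Perm ι) (i : ι) (u : ι → H) :
    cyclesScalar R (M.updateRow i u) σ {i} = cyclesScalar R M σ {i} := by
  refine cyclesScalar_congr rfl (fun _ _ _ => Iff.rfl) fun p hp => ?_
  rw [orbitProd_congr (M' := M) (fun _ => rfl) fun q hq => ?_]
  rw [Matrix.updateRow_ne]
  rintro rfl
  exact mem_offCycles_singleton.mp hp hq.symm

theorem cyclesScalar_conjTranspose (M : Matrix ι ι H) (σ : Equiv.Perm ι) (S : Set ι) :
    cyclesScalar R Mᴴ σ⁻¹ S = cyclesScalar R M σ S := by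
  refine cyclesScalar_congr ?_ (fun _ _ _ => sameCycle_inv) fun p _ => ?_
  · simp only [offCycles, sameCycle_inv]
  · rw [← star_orbitProd, scalarPart_star]

theorem cyclesScalar_revCycle {M : Matrix ι ι H} {σ : Equiv.Perm ι} {S : Set ι} {k : ι}
    (hM : k ∈ offCycles σ S → IsHermitianOn M {q | σ.SameCycle k q}) :
    cyclesScalar R M (revCycle σ k) S = cyclesScalar R M σ S := by
  have hoff : offCycles (revCycle σ k) S = offCycles σ S := by
    simp only [offCycles, sameCycle_revCycle]
  refine cyclesScalar_congr hoff (fun _ _ _ => sameCycle_revCycle) fun p hp => ?_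
  by_cases hkp : σ.SameCycle k p
  · rw [orbitProd_revCycle_of_sameCycle (hM (mem_offCycles_of_sameCycle (hoff ▸ hp) hkp.symm)) hkp,
      scalarPart_star]
  · rw [orbitProd_revCycle_of_not_sameCycle M hkp]

theorem cyclesScalar_mul_swap (M : Matrix ι ι H) {σ : Equiv.Perm ι} {i k : ι}
    (hik : ¬ σ.SameCycle i k) :
    cyclesScalar R M (σ * Equiv.swap i k) {i} = cyclesScalar R M σ {i, k} := by
  have hmem {p : ι} : p ∈ offCycles σ {i, k} ↔ ¬ σ.SameCycle i p ∧ ¬ σ.SameCycle k p := by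
    rw [mem_offCycles_insert, mem_offCycles_singleton]
  have hoff : offCycles (σ * Equiv.swap i k) {i} = offCycles σ {i, k} := by
    ext p
    rw [mem_offCycles_singleton, hmem, sameCycle_mul_swap_left_iff hik, not_or]
  rw [← hoff] at hmem
  have hpow {p : ι} (hp : p ∈ offCycles (σ * Equiv.swap i k) {i}) (t : ℕ) :
      ((σ * Equiv.swap i k) ^ t) p = (σ ^ t) p :=
    mul_swap_pow_apply_of_not_sameCycle (hmem.mp hp).1 (hmem.mp hp).2 t
  refine cyclesScalar_congr hoff (fun p hp => sameCycle_congr_of_pow_apply (hpow hp))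
    fun p hp => ?_
  rw [orbitProd_congr (hpow hp) fun _ _ => rfl]

end CyclesScalar

section Moore

variable {ι R H : Type*} [CommRing R] [Ring H] [StarRing H] [Algebra R H] [ScalarPartAlgebra R H]

variable (R) in
theorem sum_mul_orbitProd_mul_eq_sum_scalarPart [Finite ι] [Invertible (2 : R)]
    {M : Matrix ι ι H} {k : ι} {T : Finset (Equiv.Perm ι)} (hT : ∀ σ ∈ T, revCycle σ k ∈ T)
    (hM : ∀ σ ∈ T, IsHermitianOn M {q | σ.SameCycle k q}) {L N : Equiv.Perm ι → H}
    (hL : ∀ σ ∈ T, L (revCycle σ k) = L σ) (hN : ∀ σ ∈ T, N (revCycle σ k) = N σ) :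
    ∑ σ ∈ T, L σ * orbitProd M σ k * N σ =
      ∑ σ ∈ T, L σ * algebraMap R H (scalarPart (orbitProd M σ k)) * N σ :=
  sum_mul_mul_eq_sum_scalarPart R T (revCycle_involutive k) hT hL hN fun σ hσ =>
    orbitProd_revCycle_of_sameCycle (hM σ hσ) (SameCycle.refl σ k)

variable [Fintype ι] [LinearOrder ι]

variable (R) in
/-- The Moore determinant of a Hermitian matrix, as a scalar: in the Leibniz expansion each cycle
contributes the scalar part of its cycle product, so the order of the cycles and their starting
points are immaterial. -/
noncomputable def moore (M : Matrix ι ι H) : R :=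
  ∑ σ : Equiv.Perm ι, sign σ • cyclesScalar R M σ ∅

variable (R) in
/-- The `i`-th row determinant with the products of the cycles avoiding `i` replaced by their scalar
parts. It agrees with `rdet i` when `M` is Hermitian away from row `i`, but is linear in that row
for every `M` and its remaining factors commute. -/
noncomputable def mooreRow (i : ι) (M : Matrix ι ι H) : H :=
  ∑ σ : Equiv.Perm ι, sign σ • cyclesScalar R M σ {i} • orbitProd M σ i

variable (R) in
/-- The matrix of cofactors of the expansions of `mooreRow i` along row `i`, transposed like the
classical adjugate. -/
noncomputable def mooreAdjugate (M : Matrix ι ι H) : Matrix ι ι H :=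
  Matrix.of fun k i => mooreRow R i (M.updateRow i (Pi.single k 1))

theorem mooreRow_eq_moore [Invertible (2 : R)] {M : Matrix ι ι H} (hM : M.IsHermitian) (i : ι) :
    mooreRow R i M = algebraMap R H (moore R M) := by
  let L (σ : Equiv.Perm ι) : H := sign σ • algebraMap R H (cyclesScalar R M σ {i})
  have havg := sum_mul_orbitProd_mul_eq_sum_scalarPart R (T := Finset.univ) (L := L) (N := 1)
    (fun σ _ => Finset.mem_univ (revCycle σ i)) (fun σ _ => isHermitianOn_of_isHermitian hM _)
    (fun σ _ => by simp only [L, sign_revCycle,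
      cyclesScalar_revCycle fun _ => isHermitianOn_of_isHermitian hM _])
    fun _ _ => rfl
  simp only [Pi.one_apply, mul_one, L, smul_mul_assoc, ← Algebra.smul_def] at havg
  rw [mooreRow, havg, moore, map_sum]
  refine Finset.sum_congr rfl fun σ _ => ?_
  rw [cyclesScalar_eq_mul_insert M (mem_offCycles_empty σ i), insert_empty_eq, Units.smul_def,
    Units.smul_def, map_zsmul, mul_comm, map_mul, ← Algebra.smul_def]

theorem star_mooreRow (i : ι) (M : Matrix ι ι H) : star (mooreRow R i M) = mooreRow R i Mᴴ := by
  rw [mooreRow, mooreRow, star_sum]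
  refine Fintype.sum_equiv (Equiv.inv _) _ _ fun σ => ?_
  rw [Equiv.inv_apply, sign_inv, cyclesScalar_conjTranspose, ← star_orbitProd, ← star_smul_scalar,
    Units.smul_def, Units.smul_def, star_zsmul]

theorem mooreRow_updateRow_eq_sum (i : ι) (M : Matrix ι ι H) (u : ι → H) :
    mooreRow R i (M.updateRow i u) = ∑ σ : Equiv.Perm ι,
      sign σ • cyclesScalar R M σ {i} • (u (σ i) * orbitTail M σ i) := by
  refine Finset.sum_congr rfl fun σ _ => ?_
  rw [cyclesScalar_updateRow, orbitProd_eq_mul_orbitTail, Matrix.updateRow_self,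
    orbitTail_congr fun q hq => Matrix.updateRow_ne hq]

theorem mooreRow_updateRow (i : ι) (M : Matrix ι ι H) (u : ι → H) :
    mooreRow R i (M.updateRow i u) = (u ᵥ* mooreAdjugate R M) i := by
  simp only [Matrix.vecMul, dotProduct, mooreAdjugate, Matrix.of_apply,
    mooreRow_updateRow_eq_sum, Finset.mul_sum, mul_smul_comm, ← mul_assoc]
  rw [Finset.sum_comm]
  refine Finset.sum_congr rfl fun σ _ => ?_
  simp only [Pi.single_apply, mul_ite, mul_one, mul_zero, ite_mul, zero_mul, smul_ite, smul_zero,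
    Finset.sum_ite_eq, Finset.mem_univ, if_true]

theorem mooreRow_eq_zero_of_row_eq [Invertible (2 : R)] {M : Matrix ι ι H} {i k : ι}
    (hM : IsHermitianOn M {i}ᶜ) (hik : i ≠ k) (hrow : M i = M k) : mooreRow R i M = 0 := by
  let L (σ : Equiv.Perm ι) : H := sign σ • algebraMap R H (cyclesScalar R M σ {i, k})
  have havg := sum_mul_orbitProd_mul_eq_sum_scalarPart R (M := M) (k := k) (L := L)
    (T := {σ | ¬ σ.SameCycle i k}) (N := fun σ => orbitProd M σ i) ?_ ?_ ?_ ?_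
  · calc
      mooreRow R i M = ∑ σ with ¬ σ.SameCycle i k,
          (L σ * algebraMap R H (scalarPart (orbitProd M σ k)) * orbitProd M σ i -
            L σ * orbitProd M σ k * orbitProd M σ i) := by
        rw [mooreRow, sum_perm_eq_sum_not_sameCycle hik]
        refine Finset.sum_congr rfl fun σ hσ => ?_
        rw [Finset.mem_filter_univ] at hσ
        rw [orbitProd_mul_swap hσ hrow, cyclesScalar_mul_swap M hσ, Equiv.Perm.sign_mul,
          sign_swap hik, cyclesScalar_eq_mul_insert M (mem_offCycles_singleton.mpr hσ),
          Set.pair_comm, mul_neg_one, Units.neg_smul, ← sub_eq_add_neg]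
        simp only [L, smul_mul_assoc, mul_smul, ← Algebra.smul_def]
        rw [smul_comm (scalarPart _ : R)]
      _ = 0 := by rw [Finset.sum_sub_distrib, havg, sub_self]
  all_goals intro σ hσ; rw [Finset.mem_filter_univ] at hσ
  · rwa [Finset.mem_filter_univ, sameCycle_revCycle]
  · refine hM.mono fun q hq hqi => hσ ?_
    rw [Set.mem_singleton_iff] at hqi
    exact hqi ▸ SameCycle.symm hq
  · simp only [L, sign_revCycle]
    rw [cyclesScalar_revCycle fun h => absurd (SameCycle.refl σ k) (h k (by simp))]
  · exact orbitProd_revCycle_of_not_sameCycle M (mt SameCycle.symm hσ)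

theorem mul_mooreAdjugate [Invertible (2 : R)] {M : Matrix ι ι H} (hM : M.IsHermitian) :
    M * mooreAdjugate R M = moore R M • (1 : Matrix ι ι H) := by
  ext k i
  rw [Matrix.mul_apply_eq_vecMul, ← mooreRow_updateRow, Matrix.smul_apply]
  rcases eq_or_ne i k with rfl | hik
  · rw [Matrix.updateRow_eq_self, mooreRow_eq_moore hM, Matrix.one_apply_eq,
      Algebra.algebraMap_eq_smul_one]
  · rw [Matrix.one_apply_ne hik.symm, smul_zero]
    refine mooreRow_eq_zero_of_row_eq ?_ hik ?_
    · exact isHermitianOn_compl_updateRow_iff.mpr (isHermitianOn_of_isHermitian hM _)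
    · rw [Matrix.updateRow_self, Matrix.updateRow_ne hik.symm]

theorem isUnit_of_isUnit_moore [Invertible (2 : R)] {M : Matrix ι ι H} (hM : M.IsHermitian)
    (h : IsUnit (moore R M)) : IsUnit M := by
  have hright := mul_mooreAdjugate (R := R) hM
  have hleft : (mooreAdjugate R M)ᴴ * M = moore R M • (1 : Matrix ι ι H) := by
    have hstar := congrArg Matrix.conjTranspose hright
    rwa [Matrix.conjTranspose_mul, hM.eq, conjTranspose_smul_scalar, Matrix.conjTranspose_one]
      at hstar
  obtain ⟨d, hd⟩ := h
  rw [← hd] at hright hleft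
  refine isUnit_iff_exists_and_exists.mpr
    ⟨⟨d⁻¹ • mooreAdjugate R M, ?_⟩, ⟨d⁻¹ • (mooreAdjugate R M)ᴴ, ?_⟩⟩
  · rw [Matrix.mul_smul, hright, ← Units.smul_def, inv_smul_smul]
  · rw [Matrix.smul_mul, hleft, ← Units.smul_def, inv_smul_smul]

end Moore

section Congruence

variable {ι : Type*} [Fintype ι] [LinearOrder ι] {R H : Type*} [CommRing R] [Invertible (2 : R)]
  [Ring H] [StarRing H] [Algebra R H] [ScalarPartAlgebra R H]

theorem one_add_single_mul {ι H : Type*} [Fintype ι] [DecidableEq ι] [Semiring H]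
    (M : Matrix ι ι H) (i k : ι) (c : H) :
    (1 + Matrix.single i k c) * M = M.updateRow i (M i + c • M k) := by
  ext p q
  rw [add_mul, one_mul, Matrix.add_apply]
  rcases eq_or_ne p i with rfl | hp
  · simp
  · rw [Matrix.updateRow_ne hp, Matrix.single_mul_apply_of_ne _ _ _ _ _ hp, add_zero]

theorem mooreRow_updateRow_add_smul {M : Matrix ι ι H} {i k : ι} (hM : IsHermitianOn M {i}ᶜ)
    (hik : i ≠ k) (c : H) :
    mooreRow R i (M.updateRow i (M i + c • M k)) = mooreRow R i M := by
  have hzero : mooreRow R i (M.updateRow i (M k)) = 0 :=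
    mooreRow_eq_zero_of_row_eq (isHermitianOn_compl_updateRow_iff.mpr hM) hik
      (by rw [Matrix.updateRow_self, Matrix.updateRow_ne hik.symm])
  rw [mooreRow_updateRow, Matrix.add_vecMul, Matrix.smul_vecMul, Pi.add_apply, Pi.smul_apply,
    ← mooreRow_updateRow, ← mooreRow_updateRow, hzero, smul_zero, add_zero,
    Matrix.updateRow_eq_self]

theorem moore_one_add_single_conj {M : Matrix ι ι H} (hM : M.IsHermitian) {i k : ι} (hik : i ≠ k)
    (c : H) :
    moore R ((1 + Matrix.single i k c) * M * (1 + Matrix.single i k c)ᴴ) = moore R M := by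
  let P : Matrix ι ι H := 1 + Matrix.single i k c
  have hherm : (P * M * Pᴴ).IsHermitian := Matrix.isHermitian_mul_mul_conjTranspose P hM
  have hright : (M * Pᴴ)ᴴ = M.updateRow i (M i + c • M k) := by
    rw [Matrix.conjTranspose_mul, Matrix.conjTranspose_conjTranspose, hM.eq, one_add_single_mul]
  have hleft : P * M * Pᴴ = (M * Pᴴ).updateRow i ((M * Pᴴ) i + c • (M * Pᴴ) k) := by
    rw [Matrix.mul_assoc, one_add_single_mul]
  have hoff : IsHermitianOn (M * Pᴴ) {i}ᶜ := by
    rw [← isHermitianOn_compl_updateRow_iff, ← hleft]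
    exact isHermitianOn_of_isHermitian hherm _
  apply algebraMap_injective R H
  calc
    algebraMap R H (moore R (P * M * Pᴴ)) = mooreRow R i (P * M * Pᴴ) :=
      (mooreRow_eq_moore hherm i).symm
    _ = mooreRow R i (M * Pᴴ) := by rw [hleft, mooreRow_updateRow_add_smul hoff hik]
    _ = star (mooreRow R i (M * Pᴴ)ᴴ) := by rw [star_mooreRow, Matrix.conjTranspose_conjTranspose]
    _ = star (mooreRow R i M) := by
      rw [hright, mooreRow_updateRow_add_smul (isHermitianOn_of_isHermitian hM _) hik]
    _ = algebraMap R H (moore R M) := by rw [mooreRow_eq_moore hM, star_algebraMap]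

theorem moore_upper_unipotent_conj {κ κ' : Type*} [Finite κ] [Finite κ'] [DecidableEq κ]
    [DecidableEq κ'] (e : κ ⊕ κ' ≃ ι) (B : Matrix κ κ' H) {M : Matrix ι ι H}
    (hM : M.IsHermitian) :
    moore R ((Matrix.fromBlocks 1 B 0 1).reindex e e * M *
      ((Matrix.fromBlocks 1 B 0 1).reindex e e)ᴴ) = moore R M := by
  have := Fintype.ofFinite κ
  have := Fintype.ofFinite κ'
  induction B using Matrix.induction_on' generalizing M with
  | h_zero => simp [Matrix.fromBlocks_one]
  | h_add B C hB hC =>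
    have hmul : (Matrix.fromBlocks (1 : Matrix κ κ H) (B + C) 0 1).reindex e e =
        (Matrix.fromBlocks 1 B 0 1).reindex e e * (Matrix.fromBlocks 1 C 0 1).reindex e e := by
      simp [Matrix.fromBlocks_multiply, add_comm]
    rw [hmul, Matrix.conjTranspose_mul, ← hC hM,
      ← hB (Matrix.isHermitian_mul_mul_conjTranspose _ hM)]
    simp only [Matrix.mul_assoc]
  | h_std_basis p q c =>
    have hsingle : (Matrix.fromBlocks (1 : Matrix κ κ H) (Matrix.single p q c) 0 1).reindex e e =
        1 + Matrix.single (e (Sum.inl p)) (e (Sum.inr q)) c := by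
      ext x y
      obtain ⟨x, rfl⟩ := e.surjective x
      obtain ⟨y, rfl⟩ := e.surjective y
      rcases x with x | x <;> rcases y with y | y <;>
        simp [Matrix.one_apply, Matrix.single_apply]
    rw [hsingle]
    exact moore_one_add_single_conj hM (by simp) c

end Congruence

section Block

theorem exists_viaFintypeEmbedding_eq {κ ι : Type*} [Fintype κ] [DecidableEq ι] (f : κ ↪ ι)
    {σ : Equiv.Perm ι} (hσ : ∀ q ∉ Set.range f, σ q = q) :
    ∃ τ : Equiv.Perm κ, τ.viaFintypeEmbedding f = σ := by
  have hmem (x : ι) : x ∈ Set.range f ↔ σ x ∈ Set.range f := by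
    by_cases hx : x ∈ Set.range f
    · refine iff_of_true hx (by_contra fun hσx => hσx ?_)
      rwa [σ.injective (hσ _ hσx)]
    · rw [hσ x hx]
  refine ⟨f.toEquivRange.symm.permCongr (σ.subtypePerm fun x => (hmem x).symm), ?_⟩
  ext x
  by_cases hx : x ∈ Set.range f
  · obtain ⟨p, rfl⟩ := hx
    rw [Equiv.Perm.viaFintypeEmbedding_apply_image, Equiv.permCongr_apply, Equiv.symm_symm]
    exact congrArg Subtype.val (f.toEquivRange.apply_symm_apply _)
  · rw [Equiv.Perm.viaFintypeEmbedding_apply_notMem_range _ _ hx, hσ x hx]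

variable {κ ι : Type*} [LinearOrder κ] [LinearOrder ι]

theorem isCycleMin_orderEmbedding_iff [Finite κ] [Finite ι] (f : κ ↪o ι)
    {σ : Equiv.Perm ι} {τ : Equiv.Perm κ} (h : ∀ p, σ (f p) = f (τ p)) {p : κ} :
    IsCycleMin σ (f p) ↔ IsCycleMin τ p := by
  constructor <;> intro hp q hq <;> obtain ⟨t, rfl⟩ := hq.exists_nat_pow_eq
  · rw [← f.le_iff_le, ← pow_apply_map h]
    exact hp _ (sameCycle_pow_apply σ _ t)
  · rw [pow_apply_map h, f.le_iff_le]
    exact hp _ (sameCycle_pow_apply τ p t)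

variable [Fintype κ] [Fintype ι] {R H : Type*} [CommRing R] [Ring H] [StarRing H] [Algebra R H]
  [ScalarPartAlgebra R H]

open Classical in
theorem cyclesScalar_eq_prod_mul_submatrix (f : κ ↪o ι) (M : Matrix ι ι H)
    {σ : Equiv.Perm ι} {τ : Equiv.Perm κ} (h : ∀ p, σ (f p) = f (τ p))
    (hfix : ∀ q ∉ Set.range f, σ q = q) :
    cyclesScalar R M σ ∅ =
      (∏ q with q ∉ Set.range f, scalarPart (M q q)) * cyclesScalar R (M.submatrix f f) τ ∅ := by
  simp only [cyclesScalar, mem_offCycles_empty, and_true]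
  rw [← Finset.prod_filter_not_mul_prod_filter _ (· ∈ Set.range f), Finset.filter_filter,
    Finset.filter_filter]
  congr 1
  · have hmin (q : ι) (hq : q ∉ Set.range f) : IsCycleMin σ q := fun r hr =>
      (hr.eq_of_left (hfix q hq)).le
    refine Finset.prod_congr (Finset.filter_congr fun q _ => and_iff_right_of_imp (hmin q)) ?_
    intro q hq
    rw [Finset.mem_filter_univ] at hq
    rw [orbitProd_of_apply_eq (hfix q hq)]
  · symm
    refine Finset.prod_nbij f ?_ f.injective.injOn ?_ ?_
    · intro p hp
      rw [Finset.mem_filter_univ] at hp ⊢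
      exact ⟨(isCycleMin_orderEmbedding_iff f h).mpr hp, p, rfl⟩
    · rintro q hq
      simp only [Finset.coe_filter_univ, Set.mem_ofPred] at hq
      obtain ⟨hq, p, rfl⟩ := hq
      exact ⟨p, by simpa using (isCycleMin_orderEmbedding_iff f h).mp hq, rfl⟩
    · exact fun p _ => by rw [orbitProd_submatrix M f.injective h]

open Classical in
theorem moore_eq_prod_mul_moore_submatrix (f : κ ↪o ι) {M : Matrix ι ι H}
    (hM : ∀ q ∉ Set.range f, ∀ r, r ≠ q → M q r = 0) :
    moore R M = (∏ q with q ∉ Set.range f, scalarPart (M q q)) * moore R (M.submatrix f f) := by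
  rw [moore, moore, Finset.mul_sum]
  symm
  refine Fintype.sum_of_injective (fun τ => τ.viaFintypeEmbedding f.toEmbedding) ?_ _ _ ?_ ?_
  · intro τ τ' h
    ext p
    have hp := DFunLike.congr_fun h (f.toEmbedding p)
    simp only [Equiv.Perm.viaFintypeEmbedding_apply_image] at hp
    exact f.injective hp
  · intro σ hσ
    have hmove : ∃ q ∉ Set.range f, σ q ≠ q := by
      by_contra! h
      exact hσ (exists_viaFintypeEmbedding_eq f.toEmbedding h)
    obtain ⟨q, hq, hne⟩ := hmove
    rw [cyclesScalar_eq_zero_of_entry (hM q hq _ hne), smul_zero]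
  · intro τ
    rw [cyclesScalar_eq_prod_mul_submatrix f M (τ := τ), Equiv.Perm.viaFintypeEmbedding_sign,
      mul_smul_comm]
    · exact fun p => Equiv.Perm.viaFintypeEmbedding_apply_image τ f.toEmbedding p
    · exact fun q hq => Equiv.Perm.viaFintypeEmbedding_apply_notMem_range τ f.toEmbedding hq

theorem moore_fromBlocks_zero_neg_one {κ' : Type*} [Fintype κ'] [DecidableEq κ'] (e : κ ⊕ κ' ≃ ι)
    (he : ∀ p q, e (Sum.inl p) ≤ e (Sum.inl q) ↔ p ≤ q) (M : Matrix κ κ H) :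
    moore R ((Matrix.fromBlocks M 0 0 (-1)).reindex e e) =
      (-1) ^ Fintype.card κ' * moore R M := by
  classical
  let f : κ ↪o ι := OrderEmbedding.ofMapLEIff (fun p => e (Sum.inl p)) he
  have hf (q : κ') : e (Sum.inr q) ∉ Set.range f := fun ⟨p, hp⟩ =>
    Sum.inl_ne_inr (e.injective hp)
  have hrange {x : ι} (hx : x ∉ Set.range f) : ∃ q, e (Sum.inr q) = x := by
    obtain ⟨p | q, rfl⟩ := e.surjective x
    · exact absurd ⟨p, rfl⟩ hx
    · exact ⟨q, rfl⟩
  rw [moore_eq_prod_mul_moore_submatrix f]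
  · congr 1
    · rw [← Finset.card_univ, ← Finset.prod_const]
      symm
      refine Finset.prod_nbij (fun q => e (Sum.inr q)) ?_ ?_ ?_ ?_
      · exact fun q _ => Finset.mem_filter_univ _ |>.mpr (hf q)
      · exact (e.injective.comp Sum.inr_injective).injOn
      · intro x hx
        obtain ⟨q, rfl⟩ := hrange (by simpa using hx)
        exact ⟨q, by simp, rfl⟩
      · intro q _
        simp [scalarPart_one]
    · congr 1
      ext p q
      simp [f]
  · intro x hx y hxy
    obtain ⟨q, rfl⟩ := hrange hx
    obtain ⟨p | q', rfl⟩ := e.surjective y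
    · simp
    · have hne : q ≠ q' := by rintro rfl; exact hxy rfl
      simp [hne]

end Block

section DoubleDeterminant

variable {κ ι : Type*} [Fintype ι] [LinearOrder ι] {R H : Type*} [CommRing R] [Ring H]
  [StarRing H] [Algebra R H] [ScalarPartAlgebra R H]

theorem moore_fromBlocks_zero_left [Finite κ] (e : κ ⊕ κ ≃ ι) (B C D : Matrix κ κ H) :
    moore R ((Matrix.fromBlocks 0 B C D).reindex e e) =
      moore R ((Matrix.fromBlocks 0 B C 0).reindex e e) := by
  refine Finset.sum_congr rfl fun σ _ => congrArg (sign σ • ·) ?_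
  by_cases h : ∃ p q, σ (e (Sum.inl p)) = e (Sum.inl q)
  · obtain ⟨p, q, hpq⟩ := h
    rw [cyclesScalar_eq_zero_of_entry (q := e (Sum.inl p)),
      cyclesScalar_eq_zero_of_entry (q := e (Sum.inl p))] <;> simp [hpq]
  · have hswap (p : κ) : ∃ q, σ (e (Sum.inl p)) = e (Sum.inr q) := by
      obtain ⟨q | q, hq⟩ := e.surjective (σ (e (Sum.inl p)))
      · exact absurd ⟨p, q, hq.symm⟩ h
      · exact ⟨q, hq.symm⟩
    choose f hf using hswap
    have hinj : Injective f := fun p p' hp => by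
      have : σ (e (Sum.inl p)) = σ (e (Sum.inl p')) := by rw [hf, hf, hp]
      simpa using this
    have hentry (x : ι) : (Matrix.fromBlocks 0 B C D).reindex e e x (σ x) =
        (Matrix.fromBlocks 0 B C 0).reindex e e x (σ x) := by
      obtain ⟨p | q, rfl⟩ := e.surjective x
      · simp [hf]
      obtain ⟨p | q', hy⟩ := e.surjective (σ (e (Sum.inr q)))
      · simp [← hy]
      · obtain ⟨p, rfl⟩ := Finite.surjective_of_injective hinj q'
        simp [← hf] at hy
    refine cyclesScalar_congr rfl (fun _ _ _ => Iff.rfl) fun p _ => ?_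
    rw [orbitProd_congr (fun _ => rfl) fun q _ => hentry q]

variable [Fintype κ] [LinearOrder κ]

theorem moore_bordered [Invertible (2 : R)] {κ' : Type*} [Fintype κ'] [DecidableEq κ']
    (e : κ ⊕ κ' ≃ ι) (he : ∀ p q, e (Sum.inl p) ≤ e (Sum.inl q) ↔ p ≤ q) (A : Matrix κ κ' H) :
    moore R ((Matrix.fromBlocks 0 A Aᴴ (-1)).reindex e e) =
      (-1) ^ Fintype.card κ' * moore R (A * Aᴴ) := by
  have hherm : ((Matrix.fromBlocks (A * Aᴴ) 0 0 (-1)).reindex e e).IsHermitian := by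
    rw [Matrix.IsHermitian, Matrix.conjTranspose_reindex, Matrix.fromBlocks_conjTranspose]
    simp
  rw [← moore_fromBlocks_zero_neg_one e he, ← moore_upper_unipotent_conj e (-A) hherm,
    Matrix.conjTranspose_reindex, Matrix.fromBlocks_conjTranspose]
  simp [Matrix.fromBlocks_multiply]

theorem moore_mul_conjTranspose_comm [Invertible (2 : R)] (A : Matrix κ κ H) :
    moore R (A * Aᴴ) = moore R (Aᴴ * A) := by
  let e : κ ⊕ κ ≃ κ ⊕ₗ κ := toLex
  let e' : κ ⊕ κ ≃ κ ⊕ₗ κ := (Equiv.sumComm κ κ).trans e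
  have hswap : (Matrix.fromBlocks 0 Aᴴ A 0).reindex e' e' =
      (Matrix.fromBlocks 0 A Aᴴ 0).reindex e e := by
    ext x y
    obtain ⟨x, rfl⟩ := e.surjective x
    obtain ⟨y, rfl⟩ := e.surjective y
    rcases x with x | x <;> rcases y with y | y <;> simp [e']
  have hA := moore_bordered (R := R) e (fun _ _ => Sum.Lex.inl_le_inl_iff) A
  have hAH := moore_bordered (R := R) e' (fun _ _ => Sum.Lex.inr_le_inr_iff) Aᴴ
  rw [moore_fromBlocks_zero_left] at hA hAH
  rw [Matrix.conjTranspose_conjTranspose, hswap, hA] at hAH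
  exact (isUnit_neg_one.pow _).mul_left_cancel hAH

end DoubleDeterminant

section RowColumn

theorem cycleProd_eq_orbitProd {n : ℕ} {H : Type*} [Ring H] (M : Matrix (Fin n) (Fin n) H) :
    cycleProd M = orbitProd M := rfl

theorem mem_leaders {n : ℕ} {σ : Equiv.Perm (Fin n)} {i p : Fin n} :
    p ∈ leaders σ i ↔ ¬ σ.SameCycle i p ∧ IsCycleMin σ p := by
  simp [leaders, IsCycleMin]

theorem leaders_congr {n : ℕ} {σ τ : Equiv.Perm (Fin n)}
    (h : ∀ p q, σ.SameCycle p q ↔ τ.SameCycle p q) (i : Fin n) : leaders σ i = leaders τ i := by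
  simp only [leaders, h]

theorem nodup_leaders {n : ℕ} (σ : Equiv.Perm (Fin n)) (i : Fin n) : (leaders σ i).Nodup :=
  (List.nodup_finRange n).filter _

theorem pairwise_not_sameCycle_leaders {n : ℕ} (σ : Equiv.Perm (Fin n)) (i : Fin n) :
    (leaders σ i).Pairwise fun p q => ¬ σ.SameCycle p q :=
  (nodup_leaders σ i).imp_of_mem fun hp hq hpq h =>
    hpq ((mem_leaders.mp hp).2.eq_of_sameCycle (mem_leaders.mp hq).2 h)

theorem star_list_prod_map {α H : Type*} [Monoid H] [StarMul H] (l : List α) (f : α → H) :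
    star (l.map f).prod = (l.reverse.map fun m => star (f m)).prod := by
  induction l with
  | nil => simp
  | cons x l ih => simp [ih]

theorem cdet_eq_star_rdet {n : ℕ} {H : Type*} [Ring H] [StarRing H] (j : Fin n)
    (M : Matrix (Fin n) (Fin n) H) : cdet j M = star (rdet j Mᴴ) := by
  rw [cdet, rdet, star_sum]
  refine Fintype.sum_equiv (Equiv.inv _) _ _ fun σ => ?_
  have hcyc (p : Fin n) : star (cycleProd Mᴴ σ⁻¹ p) = cycleProd M σ p := by
    rw [cycleProd_eq_orbitProd, star_orbitProd, Matrix.conjTranspose_conjTranspose, inv_inv]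
    rfl
  simp only [Equiv.inv_apply, sign_inv, star_zsmul, star_mul, star_list_prod_map, hcyc,
    leaders_congr (σ := σ⁻¹) (fun _ _ => sameCycle_inv)]

variable {R H : Type*} [CommRing R] [Ring H] [StarRing H] [Algebra R H] [ScalarPartAlgebra R H]

theorem cyclesScalar_singleton_eq_prod_leaders {n : ℕ} (M : Matrix (Fin n) (Fin n) H)
    (σ : Equiv.Perm (Fin n)) (i : Fin n) :
    cyclesScalar R M σ {i} = ((leaders σ i).map fun p => scalarPart (orbitProd M σ p)).prod := by
  classical
  rw [← List.prod_toFinset _ (nodup_leaders σ i), cyclesScalar]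
  congr 1
  ext p
  rw [Finset.mem_filter_univ, List.mem_toFinset, mem_leaders, mem_offCycles_singleton, and_comm]

variable [Invertible (2 : R)]

variable (R) in
theorem sum_mul_prod_orbitProd_eq_sum_scalarPart {ι : Type*} [Finite ι] {M : Matrix ι ι H}
    {T : Finset (Equiv.Perm ι)} {l : List ι} (hT : ∀ k ∈ l, ∀ σ ∈ T, revCycle σ k ∈ T)
    (hM : ∀ k ∈ l, ∀ σ ∈ T, IsHermitianOn M {q | σ.SameCycle k q})
    (hl : ∀ σ ∈ T, l.Pairwise fun p q => ¬ σ.SameCycle p q) {L : Equiv.Perm ι → H}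
    (hL : ∀ k ∈ l, ∀ σ ∈ T, L (revCycle σ k) = L σ) :
    ∑ σ ∈ T, L σ * (l.map (orbitProd M σ)).prod =
      ∑ σ ∈ T, L σ * algebraMap R H (l.map fun p => scalarPart (orbitProd M σ p)).prod := by
  induction l generalizing L with
  | nil => simp
  | cons k l ih =>
    simp only [List.forall_mem_cons, List.pairwise_cons] at hT hM hl hL
    simp only [List.map_cons, List.prod_cons, map_mul, ← mul_assoc]
    rw [sum_mul_orbitProd_mul_eq_sum_scalarPart R hT.1 hM.1 hL.1 fun σ hσ => ?_]
    · refine ih hT.2 hM.2 (fun σ hσ => (hl σ hσ).2) fun m hm σ hσ => ?_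
      rw [hL.2 m hm σ hσ, orbitProd_revCycle_of_not_sameCycle M]
      exact mt SameCycle.symm ((hl σ hσ).1 m hm)
    · congr 1
      exact List.map_congr_left fun m hm =>
        orbitProd_revCycle_of_not_sameCycle M ((hl σ hσ).1 m hm)

variable {n : ℕ}

theorem sum_fiber_leaders_eq_sum_cyclesScalar {M : Matrix (Fin n) (Fin n) H} {i : Fin n}
    (hM : IsHermitianOn M {i}ᶜ) (l : List (Fin n)) :
    ∑ σ with leaders σ i = l,
        sign σ • orbitProd M σ i * ((leaders σ i).map (orbitProd M σ)).prod =
      ∑ σ with leaders σ i = l,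
        sign σ • orbitProd M σ i * algebraMap R H (cyclesScalar R M σ {i}) := by
  have hnot {k : Fin n} (hk : k ∈ l) {σ : Equiv.Perm (Fin n)} (hσ : leaders σ i = l) :
      ¬ σ.SameCycle i k := (mem_leaders.mp (hσ ▸ hk)).1
  have havg := sum_mul_prod_orbitProd_eq_sum_scalarPart R (M := M) (l := l)
    (T := {σ | leaders σ i = l}) (L := fun σ => sign σ • orbitProd M σ i) ?_ ?_ ?_ ?_
  · refine Eq.trans (Finset.sum_congr rfl fun σ hσ => ?_)
      (havg.trans (Finset.sum_congr rfl fun σ hσ => ?_)) <;> rw [Finset.mem_filter_univ] at hσ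
    · rw [hσ]
    · rw [cyclesScalar_singleton_eq_prod_leaders, hσ]
  all_goals
    first | intro k hk σ hσ | intro σ hσ
    rw [Finset.mem_filter_univ] at hσ
  · rw [Finset.mem_filter_univ, leaders_congr fun _ _ => sameCycle_revCycle, hσ]
  · refine hM.mono fun q hq hqi => hnot hk hσ ?_
    rw [Set.mem_singleton_iff] at hqi
    exact hqi ▸ SameCycle.symm hq
  · exact hσ ▸ pairwise_not_sameCycle_leaders σ i
  · rw [sign_revCycle, orbitProd_revCycle_of_not_sameCycle M (mt SameCycle.symm (hnot hk hσ))]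

theorem rdet_eq_mooreRow {M : Matrix (Fin n) (Fin n) H} {i : Fin n} (hM : IsHermitianOn M {i}ᶜ) :
    rdet i M = mooreRow R i M := by
  have hmaps (σ : Equiv.Perm (Fin n)) (_ : σ ∈ Finset.univ) :
      leaders σ i ∈ Finset.univ.image (leaders · i) :=
    Finset.mem_image_of_mem _ (Finset.mem_univ σ)
  calc
    rdet i M = ∑ σ, sign σ • orbitProd M σ i * ((leaders σ i).map (orbitProd M σ)).prod := by
      simp only [rdet, cycleProd_eq_orbitProd, smul_mul_assoc, Units.smul_def]
    _ = ∑ σ, sign σ • orbitProd M σ i * algebraMap R H (cyclesScalar R M σ {i}) := by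
      rw [← Finset.sum_fiberwise_of_maps_to hmaps, ← Finset.sum_fiberwise_of_maps_to hmaps]
      exact Finset.sum_congr rfl fun l _ => sum_fiber_leaders_eq_sum_cyclesScalar hM l
    _ = mooreRow R i M := by
      simp only [mooreRow, smul_mul_assoc, Algebra.smul_def, Algebra.commutes]

theorem rdet_eq_moore {M : Matrix (Fin n) (Fin n) H} (hM : M.IsHermitian) (i : Fin n) :
    rdet i M = algebraMap R H (moore R M) := by
  rw [rdet_eq_mooreRow (R := R) (isHermitianOn_of_isHermitian hM _), mooreRow_eq_moore hM]

theorem rdet_updateRow_vecMul {M : Matrix (Fin n) (Fin n) H} (hM : M.IsHermitian) (x : Fin n → H)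
    (i : Fin n) : rdet i (M.updateRow i (x ᵥ* M)) = moore R M • x i := by
  rw [rdet_eq_mooreRow (R := R)
      (isHermitianOn_compl_updateRow_iff.mpr (isHermitianOn_of_isHermitian hM _)),
    mooreRow_updateRow, Matrix.vecMul_vecMul, mul_mooreAdjugate hM, Matrix.vecMul_smul,
    Matrix.vecMul_one, Pi.smul_apply]

theorem cdet_updateCol_mulVec {M : Matrix (Fin n) (Fin n) H} (hM : M.IsHermitian) (x : Fin n → H)
    (j : Fin n) : cdet j (M.updateCol j (M *ᵥ x)) = moore R M • x j := by
  rw [cdet_eq_star_rdet, ← Matrix.updateRow_conjTranspose, Matrix.star_mulVec, hM.eq,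
    rdet_updateRow_vecMul (R := R) hM, Pi.star_apply, star_smul_scalar, star_star]

end RowColumn

section Cramer

variable {R H : Type*} [CommRing R] [Ring H] [StarRing H] [Algebra R H] [ScalarPartAlgebra R H]
  [Invertible (2 : R)]

theorem isUnit_of_isUnit_moore_mul_conjTranspose {ι : Type*} [Fintype ι] [LinearOrder ι]
    {A : Matrix ι ι H} (hA : IsUnit (moore R (A * Aᴴ))) : IsUnit A := by
  obtain ⟨B, hB⟩ := (isUnit_of_isUnit_moore
    (Matrix.isHermitian_mul_conjTranspose_self A) hA).exists_right_inv
  obtain ⟨C, hC⟩ := (isUnit_of_isUnit_moore (Matrix.isHermitian_conjTranspose_mul_self A)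
    (moore_mul_conjTranspose_comm (R := R) A ▸ hA)).exists_left_inv
  exact isUnit_iff_exists_and_exists.mpr
    ⟨⟨Aᴴ * B, by rw [← mul_assoc, hB]⟩, ⟨C * Aᴴ, by rw [mul_assoc, hC]⟩⟩

theorem ddet_eq_moore {n : ℕ} [NeZero n] (A : Matrix (Fin n) (Fin n) H) :
    ddet A = algebraMap R H (moore R (A * Aᴴ)) :=
  rdet_eq_moore (Matrix.isHermitian_mul_conjTranspose_self A) 0

end Cramer

theorem bijective_mulVec_of_isUnit {ι H : Type*} [Fintype ι] [DecidableEq ι] [Semiring H]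
    {A : Matrix ι ι H} (hA : IsUnit A) : Bijective A.mulVec :=
  ⟨Matrix.mulVec_injective_of_isUnit hA,
    Matrix.mulVec_surjective_iff_exists_right_inverse.mpr hA.exists_right_inv⟩

theorem bijective_vecMul_of_isUnit {ι H : Type*} [Fintype ι] [DecidableEq ι] [Semiring H]
    {A : Matrix ι ι H} (hA : IsUnit A) : Bijective fun x => x ᵥ* A :=
  ⟨Matrix.vecMul_injective_of_isUnit hA,
    Matrix.vecMul_surjective_iff_exists_left_inverse.mpr hA.exists_left_inv⟩

end RowColDet

open RowColDet in
theorem mainTheorem4_general {R H : Type*} [CommRing R] [Invertible (2 : R)] [Ring H] [StarRing H]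
    [Algebra R H] [ScalarPartAlgebra R H] {n : ℕ} [NeZero n] (A : Matrix (Fin n) (Fin n) H)
    (hA : IsUnit (ddet A)) :
    ∃ d : Rˣ, ddet A = algebraMap R H d ∧
      (∀ y : Fin n → H, (∃! x : Fin n → H, A *ᵥ x = y) ∧
        ∀ x : Fin n → H, A *ᵥ x = y →
          ∀ j, x j = d⁻¹ • cdet j ((Aᴴ * A).updateCol j (Aᴴ *ᵥ y))) ∧
      (∀ y : Fin n → H, (∃! x : Fin n → H, x ᵥ* A = y) ∧
        ∀ x : Fin n → H, x ᵥ* A = y →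
          ∀ i, x i = d⁻¹ • rdet i ((A * Aᴴ).updateRow i (y ᵥ* Aᴴ))) := by
  rw [ddet_eq_moore (R := R), isUnit_algebraMap_iff] at hA
  have hAunit := isUnit_of_isUnit_moore_mul_conjTranspose hA
  obtain ⟨d, hd⟩ := hA
  refine ⟨d, by rw [ddet_eq_moore (R := R), hd],
    fun y => ⟨(bijective_mulVec_of_isUnit hAunit).existsUnique y, ?_⟩,
    fun y => ⟨(bijective_vecMul_of_isUnit hAunit).existsUnique y, ?_⟩⟩
  · rintro x rfl j
    rw [Matrix.mulVec_mulVec, cdet_updateCol_mulVec (R := R)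
      (Matrix.isHermitian_conjTranspose_mul_self A), ← moore_mul_conjTranspose_comm, ← hd,
      ← Units.smul_def, inv_smul_smul]
  · rintro x rfl i
    rw [Matrix.vecMul_vecMul, rdet_updateRow_vecMul (R := R)
      (Matrix.isHermitian_mul_conjTranspose_self A), ← hd, ← Units.smul_def, inv_smul_smul]

open RowColDet in
/-- Cramer's rule for right and left systems over a quaternion algebra `ℍ[F, a, b]`
(`i² = a`, `j² = b`, `ij = k = -ji`), which may be split or a division algebra. The double
determinant is a scalar `d ∈ F`, so dividing by it means multiplying by `d⁻¹`. -/
theorem mainTheorem4 {F : Type*} [Field F] (h2 : (2 : F) ≠ 0) (a b : F) (ha : a ≠ 0) (hb : b ≠ 0)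
    (n : ℕ) [NeZero n] (A : Matrix (Fin n) (Fin n) ℍ[F, a, b]) (hA : ddet A ≠ 0) :
    ∃ d : F, ddet A = algebraMap F ℍ[F, a, b] d ∧
      (∀ y : Fin n → ℍ[F, a, b],
        (∃! x : Fin n → ℍ[F, a, b], A *ᵥ x = y) ∧
        ∀ x : Fin n → ℍ[F, a, b], A *ᵥ x = y →
          ∀ j, x j = d⁻¹ • cdet j ((Aᴴ * A).updateCol j (Aᴴ *ᵥ y))) ∧
      (∀ y : Fin n → ℍ[F, a, b],
        (∃! x : Fin n → ℍ[F, a, b], x ᵥ* A = y) ∧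
        ∀ x : Fin n → ℍ[F, a, b], x ᵥ* A = y →
          ∀ i, x i = d⁻¹ • rdet i ((A * Aᴴ).updateRow i (y ᵥ* Aᴴ))) := by
  let := invertibleOfNonzero h2
  have hunit : IsUnit (ddet A) := by
    rw [ddet_eq_moore (R := F)] at hA ⊢
    exact (isUnit_iff_ne_zero.mpr fun h => hA (by rw [h, map_zero])).map _
  obtain ⟨d, hd⟩ := mainTheorem4_general (R := F) A hunit
  exact ⟨d, by simpa only [Units.smul_def, Units.val_inv_eq_inv_val] using hd⟩
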